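/- Let $E(q)=\prod_{k\ge1}(1-q^k)$, so that $E(q^d)=\prod_{k\ge1}(1-q^{dk})$ for a positive integer $d$, and for a formal power series $F(q)=\sum_{k\ge0}a_kq^k$ write $F(q)\succeq0$ if $a_k\ge0$ for all $k\ge0$. Suppose $n$ is a positive integer. (i) If $m$ is a positive odd integer, then $$\frac{E(q^{mn})^{n(m-1)/2-m}\,E(q^m)^{(m+1)/2}\,E(q^n)}{E(q)}\succeq0.$$ (ii) If $m$ is a positive even integer, then $$\frac{E(q^{mn})^{(n-2)(m/2-1)}\,E(q^m)^{m/2-1}\,E(q^n)\,E(q^{m/2})}{E(q)\,E(q^{mn/2})}\succeq0.$$ -/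

import Mathlib

open scoped PowerSeries.WithPiTopology in
/-- The formal power series `E(q ^ d) = ∏_{k ≥ 1} (1 - q ^ (d * k))`, for a positive integer `d`;
the infinite product is taken in the topology of coefficientwise convergence. -/
noncomputable def eulerE (d : ℕ) : PowerSeries ℚ :=
  ∏' k : ℕ, (1 - (PowerSeries.X : PowerSeries ℚ) ^ (d * (k + 1)))

open scoped PowerSeries.WithPiTopology in
/-- The product defining `E(q ^ d)` converges. -/
theorem eulerE_hasProd {d : ℕ} (hd : 0 < d) :
    HasProd (fun k : ℕ => 1 - (PowerSeries.X : PowerSeries ℚ) ^ (d * (k + 1))) (eulerE d) := by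
  refine Multipliable.hasProd ?_
  simp_rw [sub_eq_add_neg]
  apply PowerSeries.WithPiTopology.multipliable_one_add_of_tendsto_order_atTop_nhds_top
  refine ENat.tendsto_nhds_top_iff_natCast_lt.mpr
    (fun n ↦ Filter.eventually_atTop.mpr ⟨n, fun m hm ↦ ?_⟩)
  rw [PowerSeries.order_neg, PowerSeries.order_X_pow]
  norm_cast
  nlinarith

open scoped PowerSeries.WithPiTopology in
/-- `E(q ^ d)` has constant term `1`; in particular it is invertible. -/
theorem constantCoeff_eulerE {d : ℕ} (hd : 0 < d) :
    PowerSeries.constantCoeff (eulerE d) = 1 := by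
  have h := (eulerE_hasProd hd).map (PowerSeries.constantCoeff (R := ℚ))
    (PowerSeries.WithPiTopology.continuous_constantCoeff ℚ)
  refine h.unique ?_
  have h1 : (PowerSeries.constantCoeff (R := ℚ)) ∘
      (fun k : ℕ => 1 - (PowerSeries.X : PowerSeries ℚ) ^ (d * (k + 1))) = fun _ => 1 := by
    funext k
    simp [hd.ne']
  rw [h1]
  exact hasProd_one

/-- `E(q ^ d)` as an element of the field of formal Laurent series, in which quotients and negative
powers are formed. -/
noncomputable def qE (d : ℕ) : LaurentSeries ℚ :=
  HahnSeries.ofPowerSeries ℤ ℚ (eulerE d)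

theorem qE_ne_zero {d : ℕ} (hd : 0 < d) : qE d ≠ 0 := by
  intro h
  have h0 : eulerE d = 0 := HahnSeries.ofPowerSeries_injective (h.trans (map_zero _).symm)
  have h1 := constantCoeff_eulerE hd
  simp [h0] at h1

/-- `F ⪰ 0`: the series `F` is a formal power series `∑_{k ≥ 0} a_k q ^ k` with all `a_k ≥ 0`. -/
def CoeffNonneg (F : LaurentSeries ℚ) : Prop :=
  ∃ f : PowerSeries ℚ, F = HahnSeries.ofPowerSeries ℤ ℚ f ∧ ∀ k : ℕ, 0 ≤ PowerSeries.coeff k f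

/-! Put `n = r + 1`. For `0 < a < m` the key identity `theta_mul_coreSeries` reads `theta a m *
coreSeries a m r = theta (a * n) (m * n) * ∏ i, theta (m * (i + 1)) (m * n)`. Since `coreSeries` is
a sum of monomials with coefficient `1`, the right side divided by `theta a m` is nonnegative. To
prove it, expand the left side over `(k, v)` and fix `s = k + ∑ v i`: the exponent then has no cross
terms in `v`. If `n ∤ s`, reflecting one coordinate cancels the fiber; if `s = k * n` (with a new
`k`), translating `v` by `k` factors it into theta terms. The Jacobi triple product turns thetas
into Euler products. Multiplying over `1 ≤ a ≤ M`, with `m = 2 * M + 1` or `m = 2 * M + 2`, collects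
all residues mod `m` and yields exactly the two quotients. -/

section

open PowerSeries
open scoped PowerSeries.WithPiTopology

/-! ### Infinite sums of monomials -/

/-- A family of exponents all of whose sublevel sets are finite. -/
def FiniteLevels {ι : Type*} (e : ι → ℕ) : Prop := ∀ k, {i | e i ≤ k}.Finite

theorem FiniteLevels.prod {ι κ : Type*} {e : ι → ℕ} {f : κ → ℕ} (he : FiniteLevels e)
    (hf : FiniteLevels f) : FiniteLevels (fun p : ι × κ => e p.1 + f p.2) := by
  intro k
  refine ((he k).prod (hf k)).subset ?_
  rintro ⟨i, j⟩ h
  simp only [Set.mem_ofPred_eq, Set.mem_prod] at h ⊢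
  omega

theorem FiniteLevels.comp_equiv {ι κ : Type*} {e : ι → ℕ} (he : FiniteLevels e) (f : κ ≃ ι) :
    FiniteLevels (e ∘ f) := fun k => (he k).preimage f.injective.injOn

theorem summable_monomial {ι : Type*} {e : ι → ℕ} (he : FiniteLevels e) (c : ι → ℚ) :
    Summable (fun i => monomial (R := ℚ) (e i) (c i)) := by
  rw [WithPiTopology.summable_iff_summable_coeff]
  intro d
  refine summable_of_hasFiniteSupport ((he d).subset ?_)
  intro i hi
  rw [Function.mem_support, coeff_monomial] at hi
  by_contra h
  exact hi (if_neg fun h' => h (by simp [h']))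

theorem coeff_tsum_monomial {ι : Type*} {e : ι → ℕ} (he : FiniteLevels e) (c : ι → ℚ) (d : ℕ) :
    coeff d (∑' i, monomial (R := ℚ) (e i) (c i)) = ∑' i, coeff d (monomial (R := ℚ) (e i) (c i)) :=
  ((WithPiTopology.hasSum_iff_hasSum_coeff ℚ).1 (summable_monomial he c).hasSum d).tsum_eq.symm

theorem tsum_monomial_mul {ι κ : Type*} {e : ι → ℕ} {f : κ → ℕ} (he : FiniteLevels e)
    (hf : FiniteLevels f) (c : ι → ℚ) (d : κ → ℚ) :
    (∑' i, monomial (R := ℚ) (e i) (c i)) * (∑' j, monomial (R := ℚ) (f j) (d j)) =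
      ∑' p : ι × κ, monomial (R := ℚ) (e p.1 + f p.2) (c p.1 * d p.2) := by
  have h := summable_monomial (he.prod hf) (fun p => c p.1 * d p.2)
  simp only [← monomial_mul_monomial] at h ⊢
  exact (summable_monomial he c).tsum_mul_tsum (summable_monomial hf d) h

/-! ### Theta exponents, theta series and progression products -/

/-- The exponent `b * k * (k - 1) / 2 + a * k` of a theta series. -/
def thetaExp (a b : ℕ) (k : ℤ) : ℕ := ((b : ℤ) * (k * (k - 1) / 2) + a * k).toNat

theorem two_dvd_mul_sub_one (k : ℤ) : 2 ∣ k * (k - 1) := by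
  rcases Int.even_or_odd k with h | h
  · exact (even_iff_two_dvd.1 h).mul_right _
  · exact (even_iff_two_dvd.1 (h.sub_odd odd_one)).mul_left _

theorem two_mul_thetaExp_of_nonneg {a b : ℕ} {k : ℤ}
    (h : 0 ≤ (b : ℤ) * (k * (k - 1)) + 2 * (a * k)) :
    2 * (thetaExp a b k : ℤ) = b * (k * (k - 1)) + 2 * (a * k) := by
  obtain ⟨t, ht⟩ := two_dvd_mul_sub_one k
  have h1 : k * (k - 1) / 2 = t := by omega
  unfold thetaExp
  rw [h1, Int.toNat_of_nonneg]
  · rw [ht]; ring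
  · rw [ht] at h; linarith

/-- `toNat` truncates nothing, because the right side equals `(b - a) * k * (k - 1) + a * k * (k +
1)`. -/
theorem two_mul_thetaExp {a b : ℕ} (hab : a ≤ b) (k : ℤ) :
    2 * (thetaExp a b k : ℤ) = b * (k * (k - 1)) + 2 * (a * k) := by
  apply two_mul_thetaExp_of_nonneg
  have h : (a : ℤ) ≤ b := by exact_mod_cast hab
  have h1 : 0 ≤ k * (k - 1) := by
    rcases le_or_gt k 0 with h | h <;> nlinarith
  have h2 : 0 ≤ k * (k + 1) := by
    rcases lt_or_ge k 0 with h | h <;> nlinarith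
  nlinarith [mul_le_mul_of_nonneg_right h h1, mul_nonneg (Int.natCast_nonneg a) h2]

/-- Dispenses with `a ≤ b`, which is lost when the induction for the `q`-binomial theorem replaces
`a` by `a + b`. -/
theorem two_mul_thetaExp_natCast (a b k : ℕ) :
    2 * (thetaExp a b k : ℤ) = b * (k * (k - 1)) + 2 * (a * k) := by
  apply two_mul_thetaExp_of_nonneg
  rcases k with _ | k
  · simp
  · push_cast
    have : 0 ≤ (b : ℤ) * ((k + 1) * k) + 2 * (a * (k + 1)) := by positivity
    linarith

theorem abs_le_thetaExp {a b : ℕ} (ha : 0 < a) (hab : a < b) (k : ℤ) :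
    |k| ≤ (thetaExp a b k : ℤ) := by
  have h := two_mul_thetaExp hab.le k
  have h0 : (1 : ℤ) ≤ a := by exact_mod_cast ha
  have h1 : (a : ℤ) + 1 ≤ b := by exact_mod_cast hab
  rcases le_or_gt k 0 with hk | hk
  · rw [abs_of_nonpos hk]
    obtain ⟨l, rfl⟩ : ∃ l, k = -l := ⟨-k, by ring⟩
    have hl : 0 ≤ l := by linarith
    have h2 : 0 ≤ l * (l - 1) := by
      rcases hl.eq_or_lt with h | h <;> nlinarith
    nlinarith [mul_le_mul_of_nonneg_right h1 hl, mul_nonneg (Int.natCast_nonneg b) h2]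
  · rw [abs_of_pos hk]
    have h2 : 0 ≤ k * (k - 1) := by nlinarith
    nlinarith [mul_nonneg (Int.natCast_nonneg b) h2]

theorem finiteLevels_thetaExp {a b : ℕ} (ha : 0 < a) (hab : a < b) :
    FiniteLevels (thetaExp a b) := by
  intro k
  refine (Set.finite_Icc (-(k : ℤ)) k).subset ?_
  intro i (hi : thetaExp a b i ≤ k)
  rw [Set.mem_Icc, ← abs_le]
  have := abs_le_thetaExp ha hab i
  omega

/-- The theta series `∑ (-1) ^ k * X ^ (b * k * (k - 1) / 2 + a * k)` over all integers `k`. -/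
noncomputable def theta (a b : ℕ) : PowerSeries ℚ :=
  ∑' k : ℤ, monomial (R := ℚ) (thetaExp a b k) ((-1) ^ k)

/-- The product of `1 - X ^ (a + b * k)` over all natural numbers `k`. -/
noncomputable def apProd (a b : ℕ) : PowerSeries ℚ :=
  ∏' k : ℕ, (1 - (X : PowerSeries ℚ) ^ (a + b * k))

theorem hasProd_apProd (a : ℕ) {b : ℕ} (hb : 0 < b) :
    HasProd (fun k : ℕ => 1 - (X : PowerSeries ℚ) ^ (a + b * k)) (apProd a b) := by
  refine Multipliable.hasProd ?_
  simp_rw [sub_eq_add_neg]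
  apply WithPiTopology.multipliable_one_add_of_tendsto_order_atTop_nhds_top
  refine ENat.tendsto_nhds_top_iff_natCast_lt.mpr
    (fun n => Filter.eventually_atTop.mpr ⟨n + 1, fun m hm => ?_⟩)
  rw [order_neg, order_X_pow]
  norm_cast
  nlinarith

theorem eulerE_eq_apProd (d : ℕ) : eulerE d = apProd d d := by
  simp only [eulerE, apProd, mul_add, mul_one, add_comm]

/-! ### Gaussian binomials and the Jacobi triple product -/

/-- The Gaussian binomial coefficient. -/
def gaussBinom {R : Type*} [CommRing R] (q : R) : ℕ → ℕ → R
  | _, 0 => 1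
  | 0, _ + 1 => 0
  | n + 1, k + 1 => gaussBinom q n k + q ^ (k + 1) * gaussBinom q n (k + 1)

section GaussBinom
variable {R : Type*} [CommRing R] (q : R)

@[simp] theorem gaussBinom_zero_right (n : ℕ) : gaussBinom q n 0 = 1 := by
  cases n <;> rfl

theorem gaussBinom_succ_succ (n k : ℕ) : gaussBinom q (n + 1) (k + 1) =
    gaussBinom q n k + q ^ (k + 1) * gaussBinom q n (k + 1) := rfl

theorem gaussBinom_eq_zero : ∀ {n k : ℕ}, n < k → gaussBinom q n k = 0
  | _, 0, h => absurd h (Nat.not_lt_zero _)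
  | 0, _ + 1, _ => rfl
  | n + 1, k + 1, h => by
    rw [gaussBinom_succ_succ, gaussBinom_eq_zero (by omega), gaussBinom_eq_zero (by omega)]
    ring

/-- The finite product of `1 - q ^ i` for `1 ≤ i ≤ n`. -/
def qFactor (n : ℕ) : R := ∏ i ∈ Finset.range n, (1 - q ^ (i + 1))

theorem qFactor_succ (n : ℕ) : qFactor q (n + 1) = qFactor q n * (1 - q ^ (n + 1)) :=
  Finset.prod_range_succ _ _

theorem gaussBinom_mul_qFactor (k l : ℕ) :
    gaussBinom q (k + l) k * qFactor q k * qFactor q l = qFactor q (k + l) := by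
  induction h : k + l generalizing k l with
  | zero =>
    obtain ⟨rfl, rfl⟩ : k = 0 ∧ l = 0 := by omega
    simp [qFactor]
  | succ n ih =>
    rcases k with _ | k
    · obtain rfl : l = n + 1 := by omega
      simp [qFactor]
    · have h1 := ih k l (by omega)
      rw [gaussBinom_succ_succ, qFactor_succ q k, qFactor_succ q n]
      rcases l with _ | l
      · obtain rfl : k = n := by omega
        rw [gaussBinom_eq_zero q (Nat.lt_succ_self k)]
        linear_combination (1 - q ^ (k + 1)) * h1
      · have h2 := ih (k + 1) l (by omega)
        rw [qFactor_succ] at h2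
        rw [qFactor_succ q l] at h1 ⊢
        obtain rfl : n = k + (l + 1) := by omega
        have h3 : q ^ (k + (l + 1) + 1) = q ^ (k + 1) * q ^ (l + 1) := by
          rw [← pow_add]; congr 1; omega
        rw [h3]
        linear_combination (1 - q ^ (k + 1)) * h1 + q ^ (k + 1) * (1 - q ^ (l + 1)) * h2

/-- Summation against Gaussian binomials, one step of the first Pascal rule. -/
theorem sum_mul_gaussBinom_succ (t : ℕ → R) (n : ℕ) :
    ∑ k ∈ Finset.range (n + 2), t k * gaussBinom q (n + 1) k =
      ∑ k ∈ Finset.range (n + 1), (t (k + 1) + t k * q ^ k) * gaussBinom q n k := by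
  have h : ∑ k ∈ Finset.range (n + 1), t k * q ^ k * gaussBinom q n k =
      t 0 + ∑ k ∈ Finset.range (n + 1), t (k + 1) * q ^ (k + 1) * gaussBinom q n (k + 1) := by
    have h1 := Finset.sum_range_succ (fun k => t k * q ^ k * gaussBinom q n k) (n + 1)
    rw [gaussBinom_eq_zero q (Nat.lt_succ_self n), mul_zero, add_zero] at h1
    rw [← h1, Finset.sum_range_succ']
    simp [add_comm]
  rw [Finset.sum_range_succ']
  simp only [add_mul, Finset.sum_add_distrib, h, gaussBinom_succ_succ, mul_add,
    gaussBinom_zero_right]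
  simp only [← mul_assoc]
  ring

end GaussBinom

theorem monomial_eq (e : ℕ) (c : ℚ) : monomial (R := ℚ) e c = C c * X ^ e := by
  rw [X_pow_eq, ← smul_eq_C_mul, ← map_smul, smul_eq_mul, mul_one]

/-- The `q`-binomial theorem: splitting off the factor `k = 0` turns `a` into `a + b`. -/
theorem prod_one_sub_eq_sum_gaussBinom (a b M : ℕ) :
    ∏ k ∈ Finset.range M, (1 - (X : PowerSeries ℚ) ^ (a + b * k)) =
      ∑ k ∈ Finset.range (M + 1),
        monomial (R := ℚ) (thetaExp a b k) ((-1) ^ (k : ℤ)) * gaussBinom (X ^ b) M k := by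
  induction M generalizing a with
  | zero => simp [thetaExp]
  | succ M ih =>
    rw [sum_mul_gaussBinom_succ, Finset.prod_range_succ']
    have h : ∀ k, a + b * (k + 1) = (a + b) + b * k := fun k => by ring
    simp only [h]
    rw [ih, Finset.sum_mul]
    refine Finset.sum_congr rfl fun k _ => ?_
    have h1 : thetaExp a b k + b * k = thetaExp (a + b) b k := by
      have := two_mul_thetaExp_natCast a b k
      have := two_mul_thetaExp_natCast (a + b) b k
      zify; push_cast at *; linarith
    have h2 : thetaExp a b (k + 1 : ℕ) = a + thetaExp (a + b) b k := by
      have := two_mul_thetaExp_natCast a b (k + 1)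
      have := two_mul_thetaExp_natCast (a + b) b k
      zify; push_cast at *; linarith
    rw [h2, ← h1]
    simp only [monomial_eq, zpow_natCast, pow_succ, ← pow_mul, pow_add, map_mul, map_neg, map_one]
    ring

/-- Finite form of the triple product. Each new factor of the second product moves the centre of the
sum by one. -/
theorem prod_mul_prod_eq_sum_gaussBinom {a b : ℕ} (hab : a ≤ b) (M N : ℕ) :
    (∏ k ∈ Finset.range M, (1 - (X : PowerSeries ℚ) ^ (a + b * k))) *
      ∏ k ∈ Finset.range N, (1 - (X : PowerSeries ℚ) ^ (b - a + b * k)) =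
      ∑ k ∈ Finset.range (M + N + 1),
        monomial (R := ℚ) (thetaExp a b (k - N)) ((-1) ^ ((k : ℤ) - N)) *
          gaussBinom (X ^ b) (M + N) k := by
  induction N with
  | zero => simpa using prod_one_sub_eq_sum_gaussBinom a b M
  | succ N ih =>
    rw [← add_assoc, sum_mul_gaussBinom_succ, Finset.prod_range_succ, ← mul_assoc, ih,
      Finset.sum_mul]
    refine Finset.sum_congr rfl fun k _ => ?_
    have h0 : ((k + 1 : ℕ) : ℤ) - (N + 1 : ℕ) = k - N := by push_cast; ring
    have h1 : thetaExp a b (k - (N + 1 : ℕ)) + b * k = thetaExp a b (k - N) + (b - a + b * N) := by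
      have := two_mul_thetaExp hab (k - N)
      have := two_mul_thetaExp hab (k - (N + 1 : ℕ))
      zify [hab]; push_cast at *; linarith
    have h2 : (-1 : ℚ) ^ ((k : ℤ) - (N + 1 : ℕ)) = - (-1) ^ ((k : ℤ) - N) := by
      rw [Nat.cast_succ, ← sub_sub, zpow_sub_one₀ (by norm_num)]; norm_num
    rw [h0, h2]
    simp only [monomial_eq, ← pow_mul, map_neg]
    linear_combination (C ((-1 : ℚ) ^ ((k : ℤ) - N)) * gaussBinom (X ^ b) (M + N) k) *
      congrArg (fun e => (X : PowerSeries ℚ) ^ e) h1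

theorem coeff_mul_eq_of_X_pow_dvd {d : ℕ} {f g : PowerSeries ℚ}
    (h : (X : PowerSeries ℚ) ^ (d + 1) ∣ g - 1) : coeff d (f * g) = coeff d f := by
  have h1 : (X : PowerSeries ℚ) ^ (d + 1) ∣ f * g - f := by
    have := h.mul_left f
    rwa [mul_sub, mul_one] at this
  have h2 := X_pow_dvd_iff.1 h1 d (Nat.lt_succ_self d)
  rwa [map_sub, sub_eq_zero] at h2

/-- Modulo `X ^ (d + 1)` all `qFactor (X ^ b) n` with `n ≥ d` are the same unit, so
`gaussBinom_mul_qFactor` makes the binomial its inverse. -/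
theorem X_pow_dvd_qFactor_mul_gaussBinom {b : ℕ} (hb : 0 < b) {d N k l : ℕ} (hN : d ≤ N)
    (hk : d ≤ k) (hl : d ≤ l) :
    (X : PowerSeries ℚ) ^ (d + 1) ∣
      qFactor (X ^ b) N * gaussBinom ((X : PowerSeries ℚ) ^ b) (k + l) k - 1 := by
  let φ := Ideal.Quotient.mk (Ideal.span {(X : PowerSeries ℚ) ^ (d + 1)})
  have hφ : ∀ n, d ≤ n → φ (qFactor (X ^ b) n) = φ (qFactor (X ^ b) d) := by
    intro n hn
    induction n, hn using Nat.le_induction with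
    | base => rfl
    | succ n hn ih =>
      have h0 : φ ((X ^ b) ^ (n + 1)) = 0 := by
        rw [Ideal.Quotient.eq_zero_iff_mem, Ideal.mem_span_singleton, ← pow_mul]
        exact pow_dvd_pow _ (by nlinarith)
      rw [qFactor_succ, map_mul, map_sub, h0, ih, map_one, sub_zero, mul_one]
  have hu : IsUnit (φ (qFactor (X ^ b) d)) := by
    refine IsUnit.map φ ?_
    rw [isUnit_iff_constantCoeff, qFactor, map_prod]
    simp [hb.ne']
  have h := congrArg φ (gaussBinom_mul_qFactor ((X : PowerSeries ℚ) ^ b) k l)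
  rw [map_mul, map_mul, hφ k hk, hφ l hl, hφ (k + l) (by omega)] at h
  have h1 := hu.mul_right_cancel (h.trans (one_mul _).symm)
  rw [← Ideal.mem_span_singleton, ← Ideal.Quotient.eq_zero_iff_mem]
  change φ _ = 0
  rw [map_sub, map_mul, map_one, hφ N hN, mul_comm, h1, sub_self]

/-- Only indices with `|k - N| ≤ d` reach degree `d`; then `N ≥ 2 * d` makes both `k` and `2 * N -
k` at least `d`, as the previous lemma requires. -/
theorem coeff_qFactor_mul_sum_eq_coeff_theta {a b : ℕ} (ha : 0 < a) (hab : a < b) {d N : ℕ}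
    (hN : 2 * d ≤ N) :
    coeff d (qFactor (X ^ b) N * ∑ k ∈ Finset.range (N + N + 1),
        monomial (R := ℚ) (thetaExp a b (k - N)) ((-1) ^ ((k : ℤ) - N)) *
          gaussBinom (X ^ b) (N + N) k) = coeff d (theta a b) := by
  rw [theta, coeff_tsum_monomial (finiteLevels_thetaExp ha hab),
    tsum_eq_sum (s := (Finset.range (N + N + 1)).image (fun k : ℕ => (k : ℤ) - N)),
    Finset.sum_image (fun x _ y _ h => by simpa using h), Finset.mul_sum, map_sum]
  · refine Finset.sum_congr rfl fun k hk => ?_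
    rw [mul_left_comm]
    have h := abs_le_thetaExp ha hab (k - N)
    rcases lt_or_ge d (thetaExp a b (k - N)) with h1 | h1
    · rw [coeff_monomial, if_neg h1.ne, monomial_eq, mul_assoc, coeff_C_mul, coeff_X_pow_mul',
        if_neg (by omega), mul_zero]
    · rw [Finset.mem_range] at hk
      obtain ⟨h2, h3⟩ := abs_le.1 h
      obtain ⟨l, hl⟩ : ∃ l, N + N = k + l := ⟨N + N - k, by omega⟩
      refine coeff_mul_eq_of_X_pow_dvd ?_
      rw [hl]
      exact X_pow_dvd_qFactor_mul_gaussBinom (by omega) (by omega) (by omega) (by omega)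
  · intro j hj
    rw [coeff_monomial, if_neg]
    intro hd
    apply hj
    have h := abs_le.1 (abs_le_thetaExp ha hab j)
    rw [Finset.mem_image]
    exact ⟨(j + N).toNat, by rw [Finset.mem_range]; omega, by omega⟩

/-- The Jacobi triple product identity. -/
theorem theta_eq_apProd {a b : ℕ} (ha : 0 < a) (hab : a < b) :
    theta a b = apProd b b * (apProd a b * apProd (b - a) b) := by
  have hb : 0 < b := ha.trans hab
  have h1 := (hasProd_apProd b hb).tendsto_prod_nat.mul
    ((hasProd_apProd a hb).tendsto_prod_nat.mul (hasProd_apProd (b - a) hb).tendsto_prod_nat)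
  refine tendsto_nhds_unique ?_ h1
  rw [WithPiTopology.tendsto_iff_coeff_tendsto]
  intro d
  refine tendsto_const_nhds.congr' ?_
  filter_upwards [Filter.eventually_ge_atTop (2 * d)] with N hN
  rw [prod_mul_prod_eq_sum_gaussBinom hab.le, ← coeff_qFactor_mul_sum_eq_coeff_theta ha hab hN,
    qFactor]
  simp only [← pow_mul, mul_add, mul_one, add_comm b]

/-- Sorts the multiples of `d` by residue mod `n`; `N` factors from each class make up the first `N
* n` factors of the whole. -/
theorem prod_apProd {d n : ℕ} (hd : 0 < d) (hn : 0 < n) :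
    ∏ i ∈ Finset.range n, apProd (d * (i + 1)) (d * n) = apProd d d := by
  have h1 := tendsto_finsetProd (Finset.range n) fun i _ =>
    (hasProd_apProd (d * (i + 1)) (Nat.mul_pos hd hn)).tendsto_prod_nat
  have h2 := (hasProd_apProd d hd).tendsto_prod_nat.comp
    (Filter.tendsto_id.atTop_mul_const' hn)
  refine tendsto_nhds_unique h1 (h2.congr fun N => ?_)
  simp only [Function.comp_apply, id]
  rw [Finset.prod_comm]
  induction N with
  | zero => simp
  | succ N ih =>
    rw [Finset.prod_range_succ, ← ih, Nat.succ_mul, Finset.prod_range_add]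
    congr 1
    refine Finset.prod_congr rfl fun i _ => ?_
    congr 2
    ring

/-! ### The lattice series and the key identity -/

theorem FiniteLevels.pi {ι : Type*} [Fintype ι] {κ : ι → Type*} {e : ∀ i, κ i → ℕ}
    (he : ∀ i, FiniteLevels (e i)) : FiniteLevels (fun v : ∀ i, κ i => ∑ i, e i (v i)) := by
  intro k
  refine (Set.Finite.pi' fun i => he i k).subset ?_
  intro v hv i
  exact (Finset.single_le_sum (f := fun i => e i (v i)) (fun _ _ => Nat.zero_le _)
    (Finset.mem_univ i)).trans hv

theorem prod_tsum_monomial {r : ℕ} {κ : Type*} {e : Fin r → κ → ℕ}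
    (he : ∀ i, FiniteLevels (e i)) (c : Fin r → κ → ℚ) :
    ∏ i, ∑' k, monomial (R := ℚ) (e i k) (c i k) =
      ∑' v : Fin r → κ, monomial (R := ℚ) (∑ i, e i (v i)) (∏ i, c i (v i)) := by
  induction r with
  | zero => simp
  | succ r ih =>
    rw [Fin.prod_univ_succ, ih (fun i => he i.succ),
      tsum_monomial_mul (he 0) (FiniteLevels.pi fun i => he (Fin.succ i)),
      ← (Fin.consEquiv fun _ : Fin (r + 1) => κ).tsum_eq]
    simp [Fin.sum_univ_succ, Fin.prod_univ_succ, Fin.consEquiv]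

/-- The exponents of the theta series attached to the lattice dual to `A_r`. -/
def coreExp (a m : ℕ) {r : ℕ} (v : Fin r → ℤ) : ℕ :=
  ∑ j, (thetaExp a m (v j) + m * ∑ i, if i < j then thetaExp 1 1 (v j - v i) else 0)

/-- The theta series attached to the lattice dual to `A_r`. -/
noncomputable def coreSeries (a m r : ℕ) : PowerSeries ℚ :=
  ∑' v : Fin r → ℤ, monomial (R := ℚ) (coreExp a m v) 1

theorem finiteLevels_coreExp {a m : ℕ} (ha : 0 < a) (ham : a < m) (r : ℕ) :
    FiniteLevels (coreExp a m (r := r)) := by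
  intro k
  refine (FiniteLevels.pi (fun _ : Fin r => finiteLevels_thetaExp ha ham) k).subset ?_
  intro v hv
  exact (Finset.sum_le_sum fun j _ => Nat.le_add_right _ _).trans hv

/-- Gathers all cross terms into a function of `∑ v i`, ready to cancel against those of `thetaExp a
m (s - ∑ v i)`. -/
theorem two_mul_coreExp {a m : ℕ} (ham : a ≤ m) {r : ℕ} (v : Fin r → ℤ) :
    2 * (coreExp a m v : ℤ) = 2 * (a * ∑ i, v i) - m * ((∑ i, v i) * (∑ i, v i + 1)) +
      m * ∑ i, ((r + 1) * (v i * (v i - 1)) + 2 * (((i : ℕ) + 1) * v i)) := by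
  induction r with
  | zero => simp [coreExp]
  | succ r ih =>
    have h1 := ih (fun i => v i.castSucc)
    set x := v (Fin.last r)
    set w := fun i : Fin r => v i.castSucc with hw
    have h2 : coreExp a m v =
        coreExp a m w + (thetaExp a m x + m * ∑ i, thetaExp 1 1 (x - w i)) := by
      simp only [coreExp, Fin.sum_univ_castSucc, Fin.castSucc_lt_castSucc_iff, Fin.castSucc_lt_last,
        if_true, if_false, add_zero, not_lt.2 (Fin.le_last _), hw, x]
    have h3 : 2 * ∑ i, (thetaExp 1 1 (x - w i) : ℤ) =
        r * (x * (x + 1)) - (2 * x + 1) * (∑ i, w i) + ∑ i, w i * w i := by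
      rw [Finset.mul_sum, Finset.mul_sum]
      have : ((r : ℤ)) * (x * (x + 1)) = ∑ i : Fin r, x * (x + 1) := by simp
      rw [this, ← Finset.sum_sub_distrib, ← Finset.sum_add_distrib]
      refine Finset.sum_congr rfl fun i _ => ?_
      rw [two_mul_thetaExp le_rfl]
      push_cast
      ring
    have h4 := two_mul_thetaExp ham x
    have h5 : ∑ i : Fin r, (((r + 1 : ℕ) + 1 : ℤ) * (w i * (w i - 1)) + 2 * (((i : ℕ) + 1) * w i)) =
        ∑ i : Fin r, ((r + 1 : ℤ) * (w i * (w i - 1)) + 2 * (((i : ℕ) + 1) * w i)) +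
          ∑ i, w i * w i - ∑ i, w i := by
      rw [← Finset.sum_add_distrib, ← Finset.sum_sub_distrib]
      refine Finset.sum_congr rfl fun i _ => ?_
      push_cast
      ring
    rw [h2, Fin.sum_univ_castSucc, Fin.sum_univ_castSucc]
    simp only [Fin.val_castSucc, Fin.val_last]
    change _ = 2 * (a * (∑ i, w i + x)) - m * ((∑ i, w i + x) * (∑ i, w i + x + 1)) + m *
      (∑ i : Fin r, (((r + 1 : ℕ) + 1 : ℤ) * (w i * (w i - 1)) + 2 * (((i : ℕ) + 1) * w i)) + _)
    rw [h5]
    push_cast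
    linear_combination h1 + h4 + m * h3

theorem two_mul_thetaExp_add_coreExp {a m : ℕ} (ham : a ≤ m) {r : ℕ} (s : ℤ) (v : Fin r → ℤ) :
    2 * ((thetaExp a m (s - ∑ i, v i) + coreExp a m v : ℕ) : ℤ) =
      m * (s * (s - 1)) + 2 * (a * s) +
        m * ∑ i, ((r + 1) * (v i * (v i - 1)) + 2 * (((i : ℕ) + 1 - s) * v i)) := by
  have h : ∑ i, ((r + 1) * (v i * (v i - 1)) + 2 * (((i : ℕ) + 1 - s) * v i)) =
      ∑ i, ((r + 1) * (v i * (v i - 1)) + 2 * (((i : ℕ) + 1) * v i)) - 2 * s * ∑ i, v i := by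
    rw [Finset.mul_sum, ← Finset.sum_sub_distrib]
    exact Finset.sum_congr rfl fun i _ => by ring
  rw [h]
  push_cast
  linear_combination two_mul_coreExp ham v + two_mul_thetaExp ham (s - ∑ i, v i)

theorem neg_one_zpow_sub_sum {r : ℕ} (s : ℤ) (v : Fin r → ℤ) :
    (-1 : ℚ) ^ (s - ∑ i, v i) = (-1) ^ s * ∏ i, (-1) ^ v i := by
  have h : (-1 : ℚ) ^ (∑ i, v i) = ∏ i, (-1 : ℚ) ^ v i := by
    induction r with
    | zero => simp
    | succ r ih =>
      rw [Fin.sum_univ_succ, Fin.prod_univ_succ, zpow_add₀ (by norm_num), ih]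
  rw [← h, sub_eq_add_neg, zpow_add₀ (by norm_num), zpow_neg, ← inv_zpow]
  norm_num

theorem tsum_fiber_eq_zero {a m : ℕ} (ham : a ≤ m) {r : ℕ} (t : ℤ) (i₀ : Fin r) (s : ℤ)
    (hs : s = (i₀ : ℕ) + 1 + (r + 1) * t) :
    ∑' v : Fin r → ℤ, monomial (R := ℚ) (thetaExp a m (s - ∑ i, v i) + coreExp a m v)
      ((-1) ^ (s - ∑ i, v i)) = 0 := by
  set f : (Fin r → ℤ) → PowerSeries ℚ := fun v =>
    monomial (R := ℚ) (thetaExp a m (s - ∑ i, v i) + coreExp a m v) ((-1) ^ (s - ∑ i, v i)) with hf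
  -- With `i₀ + 1 - s = -(r + 1) * t`, coordinate `i₀` contributes a multiple of `x * (x - (2 * t +
  -- 1))`, invariant under `x ↦ 2 * t + 1 - x`; this map changes parity, hence the sign.
  let τ : (Fin r → ℤ) ≃ (Fin r → ℤ) :=
    Equiv.piCongrRight fun i => if i = i₀ then Equiv.subLeft (2 * t + 1) else Equiv.refl ℤ
  have hτ : ∀ v i, τ v i = if i = i₀ then 2 * t + 1 - v i else v i := by
    intro v i
    simp only [τ, Equiv.piCongrRight_apply, Pi.map_apply]
    split_ifs <;> rfl
  have h : ∀ v, f (τ v) = - f v := by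
    intro v
    have h1 : thetaExp a m (s - ∑ i, τ v i) + coreExp a m (τ v) =
        thetaExp a m (s - ∑ i, v i) + coreExp a m v := by
      have h2 := two_mul_thetaExp_add_coreExp ham s v
      have h3 := two_mul_thetaExp_add_coreExp ham s (τ v)
      have h4 : ∑ i, ((r + 1) * (τ v i * (τ v i - 1)) + 2 * (((i : ℕ) + 1 - s) * τ v i)) =
          ∑ i, ((r + 1) * (v i * (v i - 1)) + 2 * (((i : ℕ) + 1 - s) * v i)) := by
        refine Finset.sum_congr rfl fun i _ => ?_
        rw [hτ]
        split_ifs with hi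
        · rw [hs, hi]; ring
        · rfl
      rw [h4, ← h2] at h3
      exact_mod_cast mul_left_cancel₀ two_ne_zero h3
    have h5 : (-1 : ℚ) ^ (s - ∑ i, τ v i) = - (-1) ^ (s - ∑ i, v i) := by
      rw [neg_one_zpow_sub_sum, neg_one_zpow_sub_sum]
      have h6 : ∀ i, (-1 : ℚ) ^ τ v i = (if i = i₀ then -1 else 1) * (-1) ^ v i := by
        intro i
        rw [hτ]
        split_ifs
        · rw [zpow_sub₀ (by norm_num), zpow_add₀ (by norm_num), zpow_mul, div_eq_mul_inv,
            ← inv_zpow]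
          norm_num
        · rw [one_mul]
      simp only [h6, Finset.prod_mul_distrib, Finset.prod_ite_eq', Finset.mem_univ, if_true]
      ring
    simp only [hf, h1, h5, map_neg]
  have h7 : ∑' v, f v = - ∑' v, f v := by
    rw [← tsum_neg, ← τ.tsum_eq f]
    exact tsum_congr h
  have h8 : (2 : ℚ) • ∑' v, f v = 0 := by
    rw [two_smul]; nth_rewrite 1 [h7]; simp
  exact (smul_eq_zero.1 h8).resolve_left two_ne_zero

theorem thetaExp_add_coreExp_shift {a m : ℕ} (ham : a ≤ m) {r : ℕ} (k : ℤ) (u : Fin r → ℤ) :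
    thetaExp a m (k * (r + 1) - ∑ i, (u i + k)) + coreExp a m (fun i => u i + k) =
      thetaExp (a * (r + 1)) (m * (r + 1)) k +
        ∑ i : Fin r, thetaExp (m * (i + 1)) (m * (r + 1)) (u i) := by
  have h1 := two_mul_thetaExp_add_coreExp ham (k * (r + 1)) (fun i => u i + k)
  have h2 := two_mul_thetaExp (Nat.mul_le_mul_right (r + 1) ham) k
  have h3 : 2 * ∑ i : Fin r, (thetaExp (m * (i + 1)) (m * (r + 1)) (u i) : ℤ) =
      m * ∑ i : Fin r, ((r + 1) * (u i * (u i - 1)) + 2 * (((i : ℕ) + 1) * u i)) := by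
    rw [Finset.mul_sum, Finset.mul_sum]
    refine Finset.sum_congr rfl fun i _ => ?_
    rw [two_mul_thetaExp (Nat.mul_le_mul_left m (by omega))]
    push_cast
    ring
  have h4 : ∑ i : Fin r, ((r + 1) * ((u i + k) * (u i + k - 1)) +
        2 * (((i : ℕ) + 1 - k * (r + 1)) * (u i + k))) =
      ∑ i : Fin r, ((r + 1) * (u i * (u i - 1)) + 2 * (((i : ℕ) + 1) * u i)) -
        r * (r + 1) * (k * k) := by
    -- The terms linear in `k` drop out because the numbers `1, …, r` have mean `(r + 1) / 2`.
    have h5 : ∑ i : Fin r, (2 * ((i : ℕ) + 1 : ℤ) - (r + 1)) = 0 := by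
      have h6 : ∀ n : ℕ, ∑ i : Fin n, (2 * ((i : ℕ) + 1 : ℤ)) = n * (n + 1) := by
        intro n
        induction n with
        | zero => simp
        | succ n ih =>
          rw [Fin.sum_univ_castSucc]
          simp only [Fin.val_castSucc, Fin.val_last, ih]
          push_cast; ring
      rw [Finset.sum_sub_distrib, h6]
      simp
    have h7 : (r : ℤ) * (r + 1) * (k * k) = ∑ i : Fin r, ((r + 1) * (k * k) : ℤ) := by
      simp; ring
    have h8 : ∑ i : Fin r, (-k * (2 * ((i : ℕ) + 1 : ℤ) - (r + 1))) = 0 := by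
      rw [← Finset.mul_sum, h5, mul_zero]
    rw [h7, ← Finset.sum_sub_distrib, ← add_zero (∑ i, _), ← h8, ← Finset.sum_add_distrib]
    refine Finset.sum_congr rfl fun i _ => ?_
    ring
  rw [h4] at h1
  zify
  refine mul_left_cancel₀ (two_ne_zero (α := ℤ)) ?_
  push_cast at *
  linear_combination h1 - h2 - h3

theorem theta_mul_coreSeries {a m : ℕ} (ha : 0 < a) (ham : a < m) (r : ℕ) :
    theta a m * coreSeries a m r = theta (a * (r + 1)) (m * (r + 1)) *
      ∏ i : Fin r, theta (m * (i + 1)) (m * (r + 1)) := by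
  have hm : 0 < m := ha.trans ham
  have he : ∀ i : Fin r, FiniteLevels (thetaExp (m * (i + 1)) (m * (r + 1))) := fun i =>
    finiteLevels_thetaExp (by positivity) (Nat.mul_lt_mul_of_pos_left (by omega) hm)
  have hk : FiniteLevels (thetaExp (a * (r + 1)) (m * (r + 1))) :=
    finiteLevels_thetaExp (by positivity) (Nat.mul_lt_mul_of_pos_right ham (by omega))
  have hlev := (finiteLevels_thetaExp ha ham).prod (finiteLevels_coreExp ha ham r)
  -- Makes the total `s = k + ∑ v i` the first summation variable.
  let ψ : ℤ × (Fin r → ℤ) ≃ ℤ × (Fin r → ℤ) :=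
    { toFun := fun p => (p.1 - ∑ i, p.2 i, p.2)
      invFun := fun p => (p.1 + ∑ i, p.2 i, p.2)
      left_inv := fun p => by simp
      right_inv := fun p => by simp }
  have hlev' : FiniteLevels (fun p : ℤ × (Fin r → ℤ) =>
      thetaExp a m (p.1 - ∑ i, p.2 i) + coreExp a m p.2) := hlev.comp_equiv ψ
  have hfib : ∀ s : ℤ, FiniteLevels (fun v : Fin r → ℤ =>
      thetaExp a m (s - ∑ i, v i) + coreExp a m v) := fun s k =>
    (finiteLevels_coreExp ha ham r k).subset fun v hv =>
      (Nat.le_add_left _ _).trans (show _ ≤ k from hv)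
  simp only [theta, coreSeries]
  rw [prod_tsum_monomial he, tsum_monomial_mul hk (FiniteLevels.pi he),
    tsum_monomial_mul (finiteLevels_thetaExp ha ham) (finiteLevels_coreExp ha ham r),
    ← ψ.tsum_eq]
  simp only [ψ, Equiv.coe_fn_mk, mul_one]
  rw [(summable_monomial hlev' fun p => (-1) ^ (p.1 - ∑ i, p.2 i)).tsum_prod'
      (fun s => summable_monomial (hfib s) _),
    (summable_monomial (hk.prod (FiniteLevels.pi he)) _).tsum_prod' (fun k =>
      summable_monomial (fun l => (FiniteLevels.pi he l).subset fun v hv =>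
        (Nat.le_add_left _ _).trans (show _ ≤ l from hv)) _)]
  have hinj : Function.Injective fun k : ℤ => k * ((r : ℤ) + 1) := fun x y h =>
    mul_right_cancel₀ (by positivity) h
  rw [← hinj.tsum_eq]
  · refine tsum_congr fun k => ?_
    rw [← (Equiv.addRight (fun _ : Fin r => k)).tsum_eq]
    refine tsum_congr fun u => ?_
    simp only [Equiv.coe_addRight, Pi.add_apply]
    rw [← thetaExp_add_coreExp_shift ham.le k u, ← neg_one_zpow_sub_sum]
    have h : k * ((r : ℤ) + 1) - ∑ i, (u i + k) = k - ∑ i, u i := by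
      rw [Finset.sum_add_distrib]; simp; ring
    rw [← h]
    rfl
  · intro s hs
    by_contra hr
    refine hs ?_
    have h0 : 0 < (r : ℤ) + 1 := by positivity
    have h1 := Int.emod_add_mul_ediv s (r + 1)
    have h2 := Int.emod_nonneg s h0.ne'
    have h3 := Int.emod_lt_of_pos s h0
    have h4 : s % (r + 1) ≠ 0 := fun h => hr ⟨s / (r + 1), by
      change s / (r + 1) * (r + 1) = s; rw [h] at h1; linarith⟩
    -- The nonzero residue lies in `1, …, r`, so coordinate `residue - 1` exists and can be
    -- reflected.
    refine tsum_fiber_eq_zero ham.le (s / (r + 1)) ⟨(s % (r + 1)).toNat - 1, by omega⟩ s ?_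
    have h5 : ((((s % (r + 1)).toNat - 1 : ℕ) : ℤ)) + 1 = s % (r + 1) := by omega
    rw [h5, h1]

theorem coeff_coreSeries_nonneg {a m : ℕ} (ha : 0 < a) (ham : a < m) (r k : ℕ) :
    0 ≤ coeff k (coreSeries a m r) := by
  rw [coreSeries, coeff_tsum_monomial (finiteLevels_coreExp ha ham r)]
  refine tsum_nonneg fun v => ?_
  rw [coeff_monomial]
  split_ifs <;> norm_num

/-! ### Products of theta series as Euler products -/

/-- By the triple product, each nonzero residue class mod `r + 1` occurs twice, as `i + 1` and as `r
- i`. The factor `eulerE (m * (r + 1)) ^ 2` avoids the exponent `r - 2`. -/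
theorem eulerE_mul_eulerE_mul_prod_theta {m : ℕ} (hm : 0 < m) (r : ℕ) :
    eulerE (m * (r + 1)) ^ 2 * ∏ i : Fin r, theta (m * (i + 1)) (m * (r + 1)) =
      eulerE (m * (r + 1)) ^ r * eulerE m ^ 2 := by
  have h1 : eulerE m = (∏ i ∈ Finset.range r, apProd (m * (i + 1)) (m * (r + 1))) *
      eulerE (m * (r + 1)) := by
    rw [eulerE_eq_apProd, eulerE_eq_apProd, ← prod_apProd hm r.succ_pos, Finset.prod_range_succ]
  have h2 : ∏ i : Fin r, theta (m * (i + 1)) (m * (r + 1)) = ∏ i ∈ Finset.range r,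
      (apProd (m * (r + 1)) (m * (r + 1)) * (apProd (m * (i + 1)) (m * (r + 1)) *
        apProd (m * (r - 1 - i + 1)) (m * (r + 1)))) := by
    rw [Finset.prod_range]
    refine Finset.prod_congr rfl fun i _ => ?_
    rw [theta_eq_apProd (by positivity) (Nat.mul_lt_mul_of_pos_left (by omega) hm),
      ← Nat.mul_sub]
    congr 5
    omega
  rw [h2, Finset.prod_mul_distrib, Finset.prod_mul_distrib, Finset.prod_const, Finset.card_range,
    Finset.prod_range_reflect (fun i => apProd (m * (i + 1)) (m * (r + 1))) r, h1,
    eulerE_eq_apProd]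
  ring

/-- The positive series attached to `a` and `m`, expressed through theta series. -/
theorem theta_mul_coreSeries_mul_eulerE {a m : ℕ} (ha : 0 < a) (ham : a < m) (r : ℕ) :
    theta a m * coreSeries a m r * eulerE (m * (r + 1)) ^ 2 =
      theta (a * (r + 1)) (m * (r + 1)) * (eulerE (m * (r + 1)) ^ r * eulerE m ^ 2) := by
  rw [theta_mul_coreSeries ha ham, ← eulerE_mul_eulerE_mul_prod_theta (ha.trans ham)]
  ring

theorem prod_theta_eq_prod_apProd {d m M : ℕ} (hd : 0 < d) (hM : 2 * M < m) :
    ∏ a ∈ Finset.range M, theta ((a + 1) * d) (m * d) =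
      eulerE (m * d) ^ M * ((∏ a ∈ Finset.range M, apProd (d * (a + 1)) (d * m)) *
        ∏ a ∈ Finset.range M, apProd (d * (m - M + a)) (d * m)) := by
  rw [← Finset.prod_range_reflect (fun a => apProd (d * (m - M + a)) (d * m)),
    ← Finset.prod_mul_distrib, ← Finset.card_range M, ← Finset.prod_const, Finset.card_range,
    ← Finset.prod_mul_distrib]
  refine Finset.prod_congr rfl fun a ha => ?_
  rw [Finset.mem_range] at ha
  rw [theta_eq_apProd (by positivity) (Nat.mul_lt_mul_of_pos_right (by omega) hd),
    eulerE_eq_apProd, ← Nat.sub_mul, mul_comm d m, mul_comm d, mul_comm d]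
  congr 5
  omega

/-- The residues `a` and `m - a` for `1 ≤ a ≤ M` exhaust the nonzero classes mod `m = 2 * M + 1`. -/
theorem prod_theta_odd {d : ℕ} (hd : 0 < d) (M : ℕ) :
    (∏ a ∈ Finset.range M, theta ((a + 1) * d) ((2 * M + 1) * d)) * eulerE ((2 * M + 1) * d) =
      eulerE ((2 * M + 1) * d) ^ M * eulerE d := by
  have h := prod_apProd hd (Nat.succ_pos (2 * M))
  rw [Finset.prod_range_succ, two_mul, Finset.prod_range_add] at h
  rw [prod_theta_eq_prod_apProd hd (by omega), eulerE_eq_apProd d, ← h, eulerE_eq_apProd]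
  have h1 : ∀ a, 2 * M + 1 - M + a = M + a + 1 := fun a => by omega
  simp only [h1, Nat.succ_eq_add_one, ← two_mul]
  rw [mul_comm (2 * M + 1) d]
  ring

/-- Here the middle class `M + 1` is missed; `eulerE ((M + 1) * d)` supplies it together with the
zero class. -/
theorem prod_theta_even {d : ℕ} (hd : 0 < d) (M : ℕ) :
    (∏ a ∈ Finset.range M, theta ((a + 1) * d) ((2 * M + 2) * d)) * eulerE ((M + 1) * d) =
      eulerE ((2 * M + 2) * d) ^ M * eulerE d := by
  have h := prod_apProd hd (Nat.succ_pos (2 * M + 1))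
  have h2 := prod_apProd (Nat.mul_pos hd M.succ_pos) (Nat.succ_pos 1)
  rw [Finset.prod_range_succ, two_mul, add_right_comm, Finset.prod_range_add,
    Finset.prod_range_succ] at h
  rw [Finset.prod_range_succ, Finset.prod_range_one] at h2
  rw [prod_theta_eq_prod_apProd hd (by omega), eulerE_eq_apProd d, ← h,
    eulerE_eq_apProd ((M + 1) * d), mul_comm (M + 1) d, ← h2]
  have h1 : ∀ a, 2 * M + 2 - M + a = M + 1 + a + 1 := fun a => by omega
  have h3 : d * (M + 1) * 2 = d * (2 * M + 2) := by ring
  have h4 : M + 1 + M + 1 = 2 * M + 2 := by ring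
  simp only [h1, Nat.succ_eq_add_one, h3, h4, zero_add, one_add_one_eq_two, mul_one]
  ring

/-! ### Assembling the two quotients -/

/-- The image of a power series among the Laurent series. -/
noncomputable abbrev toLaurent : PowerSeries ℚ →+* LaurentSeries ℚ := HahnSeries.ofPowerSeries ℤ ℚ

theorem coeffNonneg_prod_coreSeries {m M : ℕ} (hM : M < m) (r : ℕ) :
    CoeffNonneg (∏ a ∈ Finset.range M, toLaurent (coreSeries (a + 1) m r)) := by
  refine ⟨∏ a ∈ Finset.range M, coreSeries (a + 1) m r, (map_prod _ _ _).symm, ?_⟩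
  -- `M` stays fixed so that `a + 1 < m` remains available in the induction.
  have h : ∀ N ≤ M, ∀ k, 0 ≤ coeff k (∏ a ∈ Finset.range N, coreSeries (a + 1) m r) := by
    intro N
    induction N with
    | zero =>
      intro _ k
      rw [Finset.prod_range_zero, coeff_one]
      split_ifs <;> norm_num
    | succ N ih =>
      intro hN k
      rw [Finset.prod_range_succ, coeff_mul]
      exact Finset.sum_nonneg fun p _ => mul_nonneg (ih (by omega) _)
        (coeff_coreSeries_nonneg (by omega) (by omega) _ _)
  exact h M le_rfl

theorem prod_coreSeries_mul {m M : ℕ} (hM : M < m) (r : ℕ) :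
    (∏ a ∈ Finset.range M, toLaurent (theta ((a + 1) * 1) (m * 1))) *
        (∏ a ∈ Finset.range M, toLaurent (coreSeries (a + 1) m r)) * qE (m * (r + 1)) ^ (2 * M) =
      (∏ a ∈ Finset.range M, toLaurent (theta ((a + 1) * (r + 1)) (m * (r + 1)))) *
        (qE (m * (r + 1)) ^ (r * M) * qE m ^ (2 * M)) := by
  simp only [mul_one]
  rw [pow_mul, pow_mul, pow_mul, ← mul_pow, ← Finset.card_range M, ← Finset.prod_const,
    ← Finset.prod_const, Finset.card_range, ← Finset.prod_mul_distrib, ← Finset.prod_mul_distrib,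
    ← Finset.prod_mul_distrib]
  refine Finset.prod_congr rfl fun a ha => ?_
  rw [Finset.mem_range] at ha
  simp only [qE, ← map_pow, ← map_mul]
  rw [theta_mul_coreSeries_mul_eulerE (by omega) (by omega)]

theorem coeffNonneg_odd (r M : ℕ) :
    CoeffNonneg (qE ((2 * M + 1) * (r + 1)) ^ (((r : ℤ) + 1) * M - (2 * M + 1)) *
      qE (2 * M + 1) ^ (M + 1) * qE (r + 1) / qE 1) := by
  have hA : qE ((2 * M + 1) * (r + 1)) ≠ 0 := qE_ne_zero (by positivity)
  have hB : qE (2 * M + 1) ≠ 0 := qE_ne_zero (by positivity)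
  have hD : qE 1 ≠ 0 := qE_ne_zero one_pos
  have h0 := prod_coreSeries_mul (show M < 2 * M + 1 by omega) r
  have h1 := congrArg toLaurent (prod_theta_odd one_pos M)
  have h2 := congrArg toLaurent (prod_theta_odd r.succ_pos M)
  simp only [map_mul, map_prod, map_pow, Nat.succ_eq_add_one] at h1 h2
  change _ * qE _ = qE _ ^ M * qE _ at h1
  change _ * qE _ = qE _ ^ M * qE _ at h2
  have h := coeffNonneg_prod_coreSeries (show M < 2 * M + 1 by omega) r
  set H := ∏ a ∈ Finset.range M, toLaurent (coreSeries (a + 1) (2 * M + 1) r)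
  set S := ∏ a ∈ Finset.range M, toLaurent (theta ((a + 1) * 1) ((2 * M + 1) * 1))
  set T := ∏ a ∈ Finset.range M, toLaurent (theta ((a + 1) * (r + 1)) ((2 * M + 1) * (r + 1)))
  rw [mul_one] at h1
  set A := qE ((2 * M + 1) * (r + 1))
  set B := qE (2 * M + 1)
  have h3 : H * A ^ (2 * M + 1) * qE 1 = A ^ (r * M + M) * B ^ (M + 1) * qE (r + 1) := by
    -- The factor `B ^ M` lets `h1` trade `B ^ M * qE 1` for `S * B`, after which `h0` and `h2`
    -- eliminate `S` and `T`.
    refine mul_left_cancel₀ (pow_ne_zero M hB) ?_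
    have e1 : B ^ (2 * M) * B = B ^ M * B ^ (M + 1) := by ring
    linear_combination (-(H * A ^ (2 * M) * A)) * h1 + A * B * h0 +
      A ^ (r * M) * B ^ (2 * M) * B * h2 + A ^ (r * M) * A ^ M * qE (r + 1) * e1
  have h4 : qE ((2 * M + 1) * (r + 1)) ^ (((r : ℤ) + 1) * M - (2 * M + 1)) =
      A ^ (r * M + M) / A ^ (2 * M + 1) := by
    rw [zpow_sub₀ hA]
    norm_cast
    rw [Nat.succ_mul]
  have h5 : H = A ^ (r * M + M) / A ^ (2 * M + 1) * B ^ (M + 1) * qE (r + 1) / qE 1 := by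
    field_simp
    linear_combination h3
  rw [h4, ← h5]
  exact h

theorem coeffNonneg_even (r M : ℕ) :
    CoeffNonneg (qE ((2 * M + 2) * (r + 1)) ^ (((r : ℤ) - 1) * M) *
      qE (2 * M + 2) ^ M * qE (r + 1) * qE (M + 1) / (qE 1 * qE ((M + 1) * (r + 1)))) := by
  have hA : qE ((2 * M + 2) * (r + 1)) ≠ 0 := qE_ne_zero (by positivity)
  have hB : qE (2 * M + 2) ≠ 0 := qE_ne_zero (by positivity)
  have hC : qE ((M + 1) * (r + 1)) ≠ 0 := qE_ne_zero (by positivity)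
  have hD : qE 1 ≠ 0 := qE_ne_zero one_pos
  have h0 := prod_coreSeries_mul (show M < 2 * M + 2 by omega) r
  have h1 := congrArg toLaurent (prod_theta_even one_pos M)
  have h2 := congrArg toLaurent (prod_theta_even r.succ_pos M)
  simp only [map_mul, map_prod, map_pow, Nat.succ_eq_add_one] at h1 h2
  change _ * qE _ = qE _ ^ M * qE _ at h1
  change _ * qE _ = qE _ ^ M * qE _ at h2
  have h := coeffNonneg_prod_coreSeries (show M < 2 * M + 2 by omega) r
  set H := ∏ a ∈ Finset.range M, toLaurent (coreSeries (a + 1) (2 * M + 2) r)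
  set S := ∏ a ∈ Finset.range M, toLaurent (theta ((a + 1) * 1) ((2 * M + 2) * 1))
  set T := ∏ a ∈ Finset.range M, toLaurent (theta ((a + 1) * (r + 1)) ((2 * M + 2) * (r + 1)))
  rw [mul_one, mul_one] at h1
  set A := qE ((2 * M + 2) * (r + 1))
  set B := qE (2 * M + 2)
  set C' := qE (M + 1)
  set D := qE ((M + 1) * (r + 1))
  have h3 : H * A ^ (2 * M) * qE 1 * D = A ^ (r * M + M) * B ^ M * qE (r + 1) * C' := by
    refine mul_left_cancel₀ (pow_ne_zero M hB) ?_
    linear_combination (-(H * A ^ (2 * M) * D)) * h1 + C' * D * h0 +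
      A ^ (r * M) * B ^ (2 * M) * C' * h2
  have h4 : qE ((2 * M + 2) * (r + 1)) ^ (((r : ℤ) - 1) * M) =
      A ^ (r * M + M) / A ^ (2 * M) := by
    have e : ((r : ℤ) - 1) * M = ((r * M + M : ℕ) : ℤ) - ((2 * M : ℕ) : ℤ) := by push_cast; ring
    rw [e, zpow_sub₀ hA]
    norm_cast
  have h5 : H = A ^ (r * M + M) / A ^ (2 * M) * B ^ M * qE (r + 1) * C' / (qE 1 * D) := by
    field_simp
    linear_combination h3
  rw [h4, ← h5]
  exact h

end

theorem mainTheorem7 (n : ℕ) (hn : 0 < n) :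
    (∀ m : ℕ, 0 < m → Odd m →
      CoeffNonneg
        (qE (m * n) ^ ((n : ℤ) * (((m : ℤ) - 1) / 2) - (m : ℤ)) * qE m ^ ((m + 1) / 2) * qE n
          / qE 1)) ∧
    (∀ m : ℕ, 0 < m → Even m →
      CoeffNonneg
        (qE (m * n) ^ (((n : ℤ) - 2) * ((m : ℤ) / 2 - 1)) * qE m ^ ((m : ℤ) / 2 - 1)
          * qE n * qE (m / 2)
          / (qE 1 * qE (m * n / 2)))) := by
  obtain ⟨r, rfl⟩ : ∃ r, n = r + 1 := ⟨n - 1, by omega⟩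
  refine ⟨fun m _ hodd => ?_, fun m hm heven => ?_⟩
  · obtain ⟨M, rfl⟩ := hodd
    have e1 : (((2 * M + 1 : ℕ) : ℤ) - 1) / 2 = M := by omega
    have e2 : (2 * M + 1 + 1) / 2 = M + 1 := by omega
    rw [e1, e2]
    exact_mod_cast coeffNonneg_odd r M
  · obtain ⟨M, rfl⟩ : ∃ M, m = 2 * M + 2 := by
      obtain ⟨t, ht⟩ := heven
      exact ⟨t - 1, by omega⟩
    have e1 : ((2 * M + 2 : ℕ) : ℤ) / 2 - 1 = M := by omega
    have e2 : (2 * M + 2) / 2 = M + 1 := by omega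
    have e3 : (2 * M + 2) * (r + 1) / 2 = (M + 1) * (r + 1) := by
      rw [show (2 * M + 2) * (r + 1) = (M + 1) * (r + 1) * 2 by ring, Nat.mul_div_cancel _ two_pos]
    have e4 : ((r + 1 : ℕ) : ℤ) - 2 = r - 1 := by push_cast; ring
    rw [e1, e2, e3, e4, zpow_natCast]
    exact coeffNonneg_even r M
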